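/- Let $y=(y_n)_{n\ge 0}$ be a sequence of real numbers. Write $H_m(y)=(y_{i+j})_{0\le i,j\le m}$, $\Delta_m(y)=\det H_m(y)$, and let $\mathcal L_y$ be the Riesz functional on $\mathbb R[x]$, $\mathcal L_y[\sum c_nx^n]=\sum c_ny_n$. The functional $\mathcal L_y$ is positive-definite if $\mathcal L_y[\pi]>0$ for every nonzero $\pi\in\mathbb R[x]$ with $\pi\ge 0$ on $\mathbb R$. The sequence $y$ is positive if $\mathcal L_y[\pi]\ge 0$ for every $\pi\in\mathbb R[x]$ with $\pi\ge0$ on $\mathbb R$, and positive definite if $H_m(y)$ is positive definite for all $m\ge 0$. For real sequences $\sigma=(s_k)_{k\ge0}$ and $\tau=(t_k)_{k\ge1}$, the recursive matrix $R^{\sigma,\tau}=[r_{n,k}]_{n,k\ge0}$ is given by $$r_{0,0}=1,\qquad r_{n+1,k}=r_{n,k-1}+s_kr_{n,k}+t_{k+1}r_{n,k+1},\tag{A}$$ where $r_{n,k}=0$ unless $n\ge k\ge0$. The sequence $y$ is Catalan-like if $y_n=r_{n,0}$ for all $n$, for some $\sigma,\tau$ with $t_k\ne0$ for all $k\ge1$.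 A monic orthogonal polynomial sequence (OPS) for $\mathcal L_y$ is a sequence of monic $P_n\in\mathbb R[x]$ with $\deg P_n=n$, $\mathcal L_y[P_mP_n]=0$ for $m\ne n$, and $\mathcal L_y[P_n^2]\neq0$. The three-term recurrence with coefficients $\sigma,\tau$ is $$P_{k+1}(x)=(x-s_k)P_k(x)-t_kP_{k-1}(x)\quad(k\ge0),\qquad P_{-1}=0.\tag{B}$$ If $y_0=1$, then the following are equivalent: 1. $y$ is positive and Catalan-like; 2. $y$ is positive definite; 3. $\Delta_m(y)>0$ for all $m\ge 0$; 4. for some closed $K\subseteq\mathbb R$ there is a nonnegative Borel measure $\mu$ on $\mathbb R$ with $\operatorname{supp}\mu\subseteq K$, with $\operatorname{supp}\mu$ infinite, such that all moments $\int_K x^n\,d\mu$ exist and $y_n=\int_K x^n\,d\mu$ for all $n\ge 0$; 5. there is a recursive matrix $R^{\sigma,\tau}$ with $t_k>0$ for all $k\ge1$ and $r_{n,0}=y_n$ for all $n\ge 0$; 6. $\mathcal L_y$ is positive-definite and there is a monic OPS for $\mathcal L_y$; 7. there are real $\sigma,\tau$ with $t_k>0$ for all $k\ge1$ and a monic OPS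 for $\mathcal L_y$ that satisfies (B); 8. there are real $\sigma,\tau$ with $t_k>0$ for all $k\ge1$ and numbers $r_{n,k}$ satisfying (A), with $r_{n,k}=0$ unless $n\ge k\ge 0$, such that $r_{n,0}=y_n$ for all $n\ge 0$; 9. $\mathcal L_y$ is positive-definite and there are real $\sigma$, $\tau$ and $t_0$ such that the polynomials $P_n$ defined by $P_0=1$ and (B) satisfy $\mathcal L_y[1]=t_0$ and $\mathcal L_y[P_mP_n]=0$ for all $m\ne n$. Moreover, for an arbitrary real sequence $y$ (without the assumption $y_0=1$), the conditions 2, 3, 4, 6, 9, and the condition "$y_0>0$ and 7" are equivalent. -/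

import Mathlib

open Polynomial MeasureTheory

noncomputable section

namespace CatalanLike

/-- The Hankel matrix `H_m(y) = (y_{i+j})`, with `0 ≤ i, j ≤ m`. -/
def hankel (y : ℕ → ℝ) (m : ℕ) : Matrix (Fin (m + 1)) (Fin (m + 1)) ℝ :=
  Matrix.of fun i j => y ((i : ℕ) + (j : ℕ))

/-- The Hankel determinant `Δ_m(y)`. -/
def hankelDet (y : ℕ → ℝ) (m : ℕ) : ℝ := (hankel y m).det

/-- A sequence is positive definite if all its Hankel matrices are. -/
def IsPosDefSeq (y : ℕ → ℝ) : Prop := ∀ m, (hankel y m).PosDef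

/-- The infinite lower triangular matrix `R^{σ,τ}`.  Here `σ k` is `s_k` for `k ≥ 0` and `τ k` is
`t_k` for `k ≥ 1`; the value `τ 0` is not used. -/
def recursiveMatrix (σ τ : ℕ → ℝ) : ℕ → ℕ → ℝ
  | 0, 0 => 1
  | 0, _ + 1 => 0
  | n + 1, 0 => σ 0 * recursiveMatrix σ τ n 0 + τ 1 * recursiveMatrix σ τ n 1
  | n + 1, k + 1 => recursiveMatrix σ τ n k + σ (k + 1) * recursiveMatrix σ τ n (k + 1)
      + τ (k + 2) * recursiveMatrix σ τ n (k + 2)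

/-- The array `r` satisfies the defining relations of the recursive matrix of `(σ, τ)`:
`r_{0,0} = 1`, `r_{n+1,k} = r_{n,k-1} + s_k r_{n,k} + t_{k+1} r_{n,k+1}`, where `r_{n,k} = 0` unless
`n ≥ k ≥ 0`.  The case `k = 0`, in which `r_{n,-1} = 0`, is stated separately. -/
structure IsRecursiveMatrix (σ τ : ℕ → ℝ) (r : ℕ → ℕ → ℝ) : Prop where
  zero_zero : r 0 0 = 1
  eq_zero : ∀ n k, n < k → r n k = 0
  succ_zero : ∀ n, r (n + 1) 0 = σ 0 * r n 0 + τ 1 * r n 1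
  succ_succ : ∀ n k, r (n + 1) (k + 1) = r n k + σ (k + 1) * r n (k + 1) + τ (k + 2) * r n (k + 2)

theorem recursiveMatrix_spec (σ τ : ℕ → ℝ) :
    IsRecursiveMatrix σ τ (recursiveMatrix σ τ) where
  zero_zero := by simp [recursiveMatrix]
  eq_zero := by
    intro n
    induction n with
    | zero =>
      intro k hk
      obtain ⟨k, rfl⟩ := Nat.exists_eq_succ_of_ne_zero hk.ne'
      simp [recursiveMatrix]
    | succ n ih =>
      intro k hk
      obtain ⟨k, rfl⟩ := Nat.exists_eq_succ_of_ne_zero (Nat.ne_zero_of_lt hk)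
      simp only [Nat.succ_eq_add_one, recursiveMatrix]
      rw [ih k (by omega), ih (k + 1) (by omega), ih (k + 2) (by omega)]
      simp
  succ_zero := fun n => by simp only [recursiveMatrix]
  succ_succ := fun n k => by simp only [recursiveMatrix]

/-- `y` is the sequence of Catalan-like numbers of some real `(σ, τ)` with `t_k ≠ 0`, `k ≥ 1`. -/
def IsCatalanLike (y : ℕ → ℝ) : Prop :=
  ∃ σ τ : ℕ → ℝ, (∀ k, τ (k + 1) ≠ 0) ∧ ∀ n, recursiveMatrix σ τ n 0 = y n

/-- The Riesz functional `L_y(∑ c_n x^n) = ∑ c_n y_n` on `ℝ[x]`. -/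
def riesz (y : ℕ → ℝ) : ℝ[X] →ₗ[ℝ] ℝ :=
  Polynomial.lsum fun n => LinearMap.mulRight ℝ (y n)

theorem riesz_apply (y : ℕ → ℝ) (p : ℝ[X]) : riesz y p = p.sum fun n c => c * y n := rfl

/-- `y` is a positive sequence: its Riesz functional is nonnegative on all polynomials that are
nonnegative on `ℝ`. -/
def IsPositiveSeq (y : ℕ → ℝ) : Prop :=
  ∀ p : ℝ[X], (∀ x : ℝ, 0 ≤ p.eval x) → 0 ≤ riesz y p

/-- A functional on `ℝ[x]` is positive-definite if it is strictly positive on all nonzero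
polynomials that are nonnegative on `ℝ`. -/
def IsPosDefFunctional (L : ℝ[X] →ₗ[ℝ] ℝ) : Prop :=
  ∀ p : ℝ[X], p ≠ 0 → (∀ x : ℝ, 0 ≤ p.eval x) → 0 < L p

/-- `P` is a monic orthogonal polynomial sequence with respect to `L`. -/
structure IsMonicOPS (L : ℝ[X] →ₗ[ℝ] ℝ) (P : ℕ → ℝ[X]) : Prop where
  monic : ∀ n, (P n).Monic
  natDegree_eq : ∀ n, (P n).natDegree = n
  orthogonal : ∀ m n, m ≠ n → L (P m * P n) = 0
  norm_ne_zero : ∀ n, L (P n * P n) ≠ 0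

/-- The three-term recurrence `P_{k+1} = (x - s_k) P_k - t_k P_{k-1}` for all `k ≥ 0`, where
`P_{-1} = 0`. -/
structure ThreeTermRecurrence (σ τ : ℕ → ℝ) (P : ℕ → ℝ[X]) : Prop where
  one : P 1 = (X - C (σ 0)) * P 0
  add_two : ∀ k, P (k + 2) = (X - C (σ (k + 1))) * P (k + 1) - C (τ (k + 1)) * P k

/-- `μ` is a `K`-measure (a Borel measure on `ℝ` with support in the closed set `K`) whose moments
all exist and are the terms of `y`. -/
structure IsRepresentingMeasure (K : Set ℝ) (y : ℕ → ℝ) (μ : Measure ℝ) : Prop where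
  isClosed : IsClosed K
  support_subset : μ.support ⊆ K
  integrable : ∀ n : ℕ, IntegrableOn (fun x : ℝ => x ^ n) K μ
  moment : ∀ n : ℕ, y n = ∫ x in K, x ^ n ∂μ

/-- `y` admits a `K`-measure with infinite support, for some closed `K ⊆ ℝ`. -/
def AdmitsInfiniteMeasure (y : ℕ → ℝ) : Prop :=
  ∃ (K : Set ℝ) (μ : Measure ℝ), IsRepresentingMeasure K y μ ∧ μ.support.Infinite

/-- There is a recursive matrix `R^{σ,τ}` with all `t_k > 0` and `0`-th column `y`. -/
def HasPosRecursiveMatrix (y : ℕ → ℝ) : Prop :=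
  ∃ σ τ : ℕ → ℝ, (∀ k, 0 < τ (k + 1)) ∧ ∀ n, recursiveMatrix σ τ n 0 = y n

/-- `L_y` is positive-definite and there is a monic OPS with respect to it. -/
def HasPosDefMonicOPS (y : ℕ → ℝ) : Prop :=
  IsPosDefFunctional (riesz y) ∧ ∃ P : ℕ → ℝ[X], IsMonicOPS (riesz y) P

/-- There are `σ` and `τ` with all `t_k > 0` such that a monic OPS with respect to `L_y` satisfies
the three-term recurrence with these coefficients. -/
def HasPosOPSRecurrence (y : ℕ → ℝ) : Prop :=
  ∃ σ τ : ℕ → ℝ, (∀ k, 0 < τ (k + 1)) ∧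
    ∃ P : ℕ → ℝ[X], IsMonicOPS (riesz y) P ∧ ThreeTermRecurrence σ τ P

/-- There are `σ` and `τ` with all `t_k > 0` and an array that satisfies the recurrence relations
of the recursive matrix for them and has `0`-th column `y`. -/
def HasPosMatrixRecurrence (y : ℕ → ℝ) : Prop :=
  ∃ σ τ : ℕ → ℝ, (∀ k, 0 < τ (k + 1)) ∧
    ∃ r : ℕ → ℕ → ℝ, IsRecursiveMatrix σ τ r ∧ ∀ n, r n 0 = y n

/-- `L_y` is positive-definite and satisfies `L_y[1] = t_0` and `L_y[P_m P_n] = 0` for `m ≠ n`,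
where, for some real `σ = (s_k)` and `τ = (t_k)`, the polynomials `P_n` are defined by `P_{-1} = 0`,
`P_0 = 1` and the three-term recurrence. -/
def HasPosDefFavard (y : ℕ → ℝ) : Prop :=
  IsPosDefFunctional (riesz y) ∧
    ∃ (σ τ : ℕ → ℝ) (P : ℕ → ℝ[X]), P 0 = 1 ∧ ThreeTermRecurrence σ τ P ∧
      riesz y 1 = τ 0 ∧ ∀ m n, m ≠ n → riesz y (P m * P n) = 0

end CatalanLike

end

open Polynomial MeasureTheory

noncomputable section
namespace CatalanLike

/-! Every condition is compared with one property of the Riesz functional: L(p²) > 0 for all nonzero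
p (`IsSqPos`). On polynomials of degree at most m, L(p²) is the quadratic form of the Hankel matrix,
which gives positive definiteness; the passage to determinants is an induction by Schur complements.
A nonnegative polynomial splits off squared linear factors at its minima, so positivity on squares
is already positivity on all nonnegative polynomials (`IsSqPos.mul_sq_pos`).

Positivity on squares makes p, q ↦ L(pq) an inner product, and orthogonalizing the powers of x gives
monic polynomials with a three-term recurrence in which t_{n+1} = L(P_{n+1}²)/L(P_n²) > 0
(`exists_ops`). Conversely, orthogonal monic polynomials with positive norms diagonalize the form
(`isSqPos_of_orthogonal`). Recursive matrices enter through the identity L(x^n P_k) = r_{n,k}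
t_1⋯t_k, which turns a recursive matrix into orthogonality and back. It gives L(P_n²) = t_1⋯t_n, so
that t_k ≠ 0 suffices once L is known to be nonnegative.

The measure comes from Hamburger's theorem (`exists_measure_of_nonneg`): M. Riesz extension to
polynomially bounded functions, then Riesz–Markov–Kakutani. Infinite support corresponds to strict
positivity, since a nonzero polynomial has only finitely many zeros. -/

/-- A functional is strictly positive on squares of nonzero polynomials. -/
def IsSqPos (L : ℝ[X] →ₗ[ℝ] ℝ) : Prop := ∀ p : ℝ[X], p ≠ 0 → 0 < L (p * p)

theorem riesz_X_pow (y : ℕ → ℝ) (n : ℕ) : riesz y (X ^ n) = y n := by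
  rw [riesz_apply, ← monomial_one_right_eq_X_pow, sum_monomial_index _ _ (by simp), one_mul]

theorem riesz_one (y : ℕ → ℝ) : riesz y 1 = y 0 := by
  simpa using riesz_X_pow y 0

/-! ### Nonnegative polynomials and squares -/

/-- A nonnegative polynomial is its minimum plus a multiple of a square of a linear factor. -/
theorem exists_eq_sq_mul_add_C (p : ℝ[X]) (hp : ∀ x : ℝ, 0 ≤ p.eval x) :
    ∃ (a m : ℝ) (q : ℝ[X]), 0 ≤ m ∧ (∀ x : ℝ, 0 ≤ q.eval x) ∧ p = (X - C a) ^ 2 * q + C m := by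
  obtain ⟨a, ha⟩ := p.exists_forall_norm_le
  have ha' : ∀ x, p.eval a ≤ p.eval x := fun x => by
    simpa [abs_of_nonneg (hp _)] using ha x
  -- The derivative vanishes at the minimum, so `a` is at least a double root of p - p(a).
  have hdvd : (X - C a) ^ 2 ∣ p - C (p.eval a) := by
    by_cases h0 : p - C (p.eval a) = 0
    · rw [h0]; exact dvd_zero _
    rw [← le_rootMultiplicity_iff h0]
    refine (one_lt_rootMultiplicity_iff_isRoot h0).2 ⟨by simp, ?_⟩
    have hmin : IsLocalMin (fun x => p.eval x) a := Filter.Eventually.of_forall ha'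
    have := hmin.deriv_eq_zero
    simpa [IsRoot] using this
  obtain ⟨q, hq⟩ := hdvd
  refine ⟨a, p.eval a, q, hp a, ?_, by rw [← hq]; ring⟩
  -- Away from `a` the sign of q can be read off after division by (x - a)²; continuity and density
  -- cover the point `a`.
  have hclosed : IsClosed {x : ℝ | 0 ≤ q.eval x} := isClosed_le continuous_const q.continuous
  have hsub : ({a}ᶜ : Set ℝ) ⊆ {x : ℝ | 0 ≤ q.eval x} := by
    intro x hx
    have h1 : (x - a) ^ 2 * q.eval x = p.eval x - p.eval a := by
      have := congrArg (eval x) hq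
      simpa using this.symm
    have h2 : 0 < (x - a) ^ 2 := by
      have : x - a ≠ 0 := sub_ne_zero.2 hx
      positivity
    refine nonneg_of_mul_nonneg_right ?_ h2
    rw [h1]
    exact sub_nonneg.2 (ha' x)
  intro x
  exact closure_minimal hsub hclosed (dense_compl_singleton a x)

/-- Write p = (X - a)²q + m. Then r²p = (r(X - a))²q + m r², and q has degree two less than p unless
q = 0. The extra square r² is what lets the induction absorb the factor (X - a)². -/
theorem IsSqPos.mul_sq_pos {L : ℝ[X] →ₗ[ℝ] ℝ} (hL : IsSqPos L) :
    ∀ (n : ℕ) (p : ℝ[X]), p.natDegree ≤ n → p ≠ 0 → (∀ x : ℝ, 0 ≤ p.eval x) →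
      ∀ r : ℝ[X], r ≠ 0 → 0 < L (r * r * p) := by
  have key : ∀ (r : ℝ[X]) (a m : ℝ) (q : ℝ[X]), L (r * r * ((X - C a) ^ 2 * q + C m)) =
      L ((r * (X - C a)) * (r * (X - C a)) * q) + m * L (r * r) := by
    intro r a m q
    rw [show r * r * ((X - C a) ^ 2 * q + C m) =
      (r * (X - C a)) * (r * (X - C a)) * q + m • (r * r) by rw [smul_eq_C_mul]; ring]
    simp
  intro n
  induction n using Nat.strong_induction_on with
  | _ n ih =>
    intro p hpn hp0 hp r hr
    obtain ⟨a, m, q, hm, hq, rfl⟩ := exists_eq_sq_mul_add_C p hp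
    rw [key]
    have hXa : (X - C a : ℝ[X]) ≠ 0 := X_sub_C_ne_zero a
    by_cases hq0 : q = 0
    · subst hq0
      have hm0 : m ≠ 0 := by
        rintro rfl
        simp at hp0
      have := mul_pos (lt_of_le_of_ne hm hm0.symm) (hL r hr)
      simpa using this
    · have hdeg : ((X - C a) ^ 2 * q + C m).natDegree = 2 + q.natDegree := by
        rw [natDegree_add_C, natDegree_mul (pow_ne_zero 2 hXa) hq0, natDegree_pow, natDegree_X_sub_C]
      have h1 := ih q.natDegree (by omega) q le_rfl hq0 hq (r * (X - C a)) (mul_ne_zero hr hXa)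
      have h2 := mul_nonneg hm (hL r hr).le
      linarith

theorem isPosDefFunctional_iff_isSqPos {L : ℝ[X] →ₗ[ℝ] ℝ} : IsPosDefFunctional L ↔ IsSqPos L := by
  constructor
  · intro h p hp
    exact h _ (mul_ne_zero hp hp) fun x => by simpa using mul_self_nonneg _
  · intro h p hp hp'
    simpa using h.mul_sq_pos _ p le_rfl hp hp' 1 one_ne_zero

/-! ### Hankel matrices and their determinants -/

/-- The quadratic form of a Hankel matrix is the Riesz functional on squares. -/
theorem riesz_sq_eq (y : ℕ → ℝ) (m : ℕ) (c : Fin (m + 1) → ℝ) :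
    riesz y ((∑ i, C (c i) * X ^ (i : ℕ)) * (∑ i, C (c i) * X ^ (i : ℕ))) =
      star c ⬝ᵥ (hankel y m).mulVec c := by
  rw [Finset.sum_mul_sum, map_sum]
  simp only [dotProduct, Matrix.mulVec, star_trivial, Finset.mul_sum, map_sum]
  refine Finset.sum_congr rfl fun i _ => Finset.sum_congr rfl fun j _ => ?_
  rw [show C (c i) * X ^ (i : ℕ) * (C (c j) * X ^ (j : ℕ)) =
    (c i * c j) • (X : ℝ[X]) ^ ((i : ℕ) + (j : ℕ)) by rw [smul_eq_C_mul, C_mul, pow_add]; ring,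
    map_smul, riesz_X_pow]
  simp [hankel]
  ring

theorem hankel_isHermitian (y : ℕ → ℝ) (m : ℕ) : (hankel y m).IsHermitian := by
  ext i j
  simp [hankel, add_comm]

theorem isPosDefSeq_iff_isSqPos {y : ℕ → ℝ} : IsPosDefSeq y ↔ IsSqPos (riesz y) := by
  constructor
  · intro h p hp
    have hsum : p = ∑ i : Fin (p.natDegree + 1), C (p.coeff i) * X ^ (i : ℕ) := by
      conv_lhs => rw [p.as_sum_range_C_mul_X_pow]
      exact Finset.sum_range fun i => C (p.coeff i) * X ^ i
    have h1 := riesz_sq_eq y p.natDegree fun i => p.coeff i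
    rw [← hsum] at h1
    rw [h1]
    refine (h p.natDegree).dotProduct_mulVec_pos fun h0 => hp ?_
    have := congrFun h0 (Fin.last _)
    simpa using this
  · intro h m
    refine .of_dotProduct_mulVec_pos (hankel_isHermitian y m) fun c hc => ?_
    rw [← riesz_sq_eq]
    refine h _ fun h0 => hc ?_
    ext i
    have := congrArg (fun p => coeff p (i : ℕ)) h0
    simpa [finsetSum_coeff, coeff_C_mul, coeff_X_pow, Fin.val_inj] using this

/-- Sylvester's criterion: H_m is the leading block of H_{m+1}, and the complementary block has size
one. The Schur complement is therefore the scalar Δ_{m+1}/Δ_m > 0. -/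
theorem isPosDefSeq_iff_hankelDet_pos {y : ℕ → ℝ} : IsPosDefSeq y ↔ ∀ m, 0 < hankelDet y m := by
  constructor
  · exact fun h m => (h m).det_pos
  intro h m
  induction m with
  | zero =>
    refine .of_dotProduct_mulVec_pos (hankel_isHermitian y 0) fun c hc => ?_
    have h0 := h 0
    simp only [hankelDet, hankel] at h0
    have hc0 : c 0 ≠ 0 := fun h' => hc (by ext i; fin_cases i; exact h')
    have : 0 < c 0 * c 0 * y 0 := mul_pos (mul_self_pos.2 hc0) (by simpa using h0)
    simpa [dotProduct, Matrix.mulVec, hankel, mul_comm, mul_left_comm] using this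
  | succ m ih =>
    let e : Fin (m + 1) ⊕ Fin 1 ≃ Fin (m + 1 + 1) := finSumFinEquiv
    set M := (hankel y (m + 1)).submatrix e e with hM
    let B := M.toBlocks₁₂
    have hA : M.toBlocks₁₁ = hankel y m := by
      ext i j
      simp [hM, e, hankel, Matrix.toBlocks₁₁]
    have hC : M.toBlocks₂₁ = B.conjTranspose := by
      ext i j
      simp [hM, B, hankel, Matrix.toBlocks₁₂, Matrix.toBlocks₂₁, add_comm]
    have hMb : M = Matrix.fromBlocks (hankel y m) B B.conjTranspose M.toBlocks₂₂ := by
      rw [← hA, ← hC, Matrix.fromBlocks_toBlocks]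
    have hdet : M.det = hankelDet y (m + 1) := Matrix.det_submatrix_equiv_self _ _
    let : Invertible (hankel y m) := ih.isUnit.invertible
    have hd := Matrix.det_fromBlocks₁₁ (hankel y m) B B.conjTranspose M.toBlocks₂₂
    rw [← hMb, hdet, Matrix.invOf_eq_nonsing_inv] at hd
    have hS : 0 < (M.toBlocks₂₂ - B.conjTranspose * (hankel y m)⁻¹ * B).det := by
      have h1 := h (m + 1)
      rw [hd] at h1
      exact pos_of_mul_pos_right h1 (h m).le
    have hSp : (M.toBlocks₂₂ - B.conjTranspose * (hankel y m)⁻¹ * B).PosSemidef := by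
      refine .of_dotProduct_mulVec_nonneg (by ext i j; simp [Subsingleton.elim i j]) fun c => ?_
      rw [Matrix.det_unique] at hS
      have := mul_nonneg (mul_self_nonneg (c 0)) hS.le
      simpa [dotProduct, Matrix.mulVec, mul_comm, mul_left_comm, mul_assoc] using this
    have hMp : M.PosSemidef := by
      rw [hMb]
      exact (Matrix.PosDef.fromBlocks₁₁ B _ ih).2 hSp
    -- The Schur complement criterion yields only semidefiniteness; the nonzero determinant upgrades
    -- it.
    have hMd : M.PosDef := hMp.posDef_iff_det_ne_zero.2 (by rw [hdet]; exact (h _).ne')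
    have := hMd.submatrix e.symm.injective
    simpa [hM] using this

/-! ### Three-term recurrences and orthogonal expansions -/

/-- The polynomials defined by the three-term recurrence. -/
def recPoly (σ τ : ℕ → ℝ) : ℕ → ℝ[X]
  | 0 => 1
  | 1 => X - C (σ 0)
  | k + 2 => (X - C (σ (k + 1))) * recPoly σ τ (k + 1) - C (τ (k + 1)) * recPoly σ τ k

theorem recPoly_spec (σ τ : ℕ → ℝ) : ThreeTermRecurrence σ τ (recPoly σ τ) where
  one := by simp [recPoly]
  add_two k := by rw [recPoly]

section

variable {σ τ : ℕ → ℝ} {P : ℕ → ℝ[X]}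

theorem ThreeTermRecurrence.monic_natDegree (h : ThreeTermRecurrence σ τ P) (h0 : P 0 = 1) :
    ∀ n, (P n).Monic ∧ (P n).natDegree = n := by
  have h1 : (P 1).Monic ∧ (P 1).natDegree = 1 := by
    rw [h.one, h0, mul_one]
    exact ⟨monic_X_sub_C _, natDegree_X_sub_C _⟩
  intro n
  induction n using Nat.twoStepInduction with
  | zero => simp [h0]
  | one => exact h1
  | more k ih0 ih1 =>
    have hm : ((X - C (σ (k + 1))) * P (k + 1)).Monic := (monic_X_sub_C _).mul ih1.1
    have hd : ((X - C (σ (k + 1))) * P (k + 1)).natDegree = k + 2 := by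
      rw [(monic_X_sub_C _).natDegree_mul ih1.1, natDegree_X_sub_C, ih1.2]
      ring
    have hlt : (C (τ (k + 1)) * P k).natDegree < ((X - C (σ (k + 1))) * P (k + 1)).natDegree := by
      rw [hd]
      have := natDegree_C_mul_le (τ (k + 1)) (P k)
      omega
    rw [h.add_two]
    exact ⟨hm.sub_of_left (degree_lt_degree hlt), by rw [natDegree_sub_eq_left_of_natDegree_lt hlt, hd]⟩

theorem ThreeTermRecurrence.X_mul_zero (h : ThreeTermRecurrence σ τ P) :
    X * P 0 = P 1 + C (σ 0) * P 0 := by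
  rw [h.one]; ring

theorem ThreeTermRecurrence.X_mul_succ (h : ThreeTermRecurrence σ τ P) (k : ℕ) :
    X * P (k + 1) = P (k + 2) + C (σ (k + 1)) * P (k + 1) + C (τ (k + 1)) * P k := by
  rw [h.add_two]; ring

end

theorem map_C_mul (L : ℝ[X] →ₗ[ℝ] ℝ) (a : ℝ) (p : ℝ[X]) : L (C a * p) = a * L p := by
  rw [← smul_eq_C_mul, map_smul, smul_eq_mul]

theorem map_mul_C_mul (L : ℝ[X] →ₗ[ℝ] ℝ) (a : ℝ) (p q : ℝ[X]) :
    L (q * (C a * p)) = a * L (q * p) := by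
  rw [mul_left_comm, map_C_mul]

/-- An orthogonal sequence of monic polynomials with positive norms has a functional that is
positive on squares. -/
theorem isSqPos_of_orthogonal {L : ℝ[X] →ₗ[ℝ] ℝ} {P : ℕ → ℝ[X]} (hm : ∀ n, (P n).Monic)
    (hd : ∀ n, (P n).natDegree = n) (ho : ∀ m n, m ≠ n → L (P m * P n) = 0)
    (hp : ∀ n, 0 < L (P n * P n)) : IsSqPos L := by
  -- The `P i` span: subtracting the coefficient at degree n + 1 times `P (n + 1)` lowers the degree
  -- bound. In this basis L(p²) becomes the sum of c_i² L(P_i²).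
  have hexp : ∀ (n : ℕ) (p : ℝ[X]), p.natDegree < n →
      ∃ c : ℕ → ℝ, p = ∑ i ∈ Finset.range n, C (c i) * P i := by
    intro n
    induction n with
    | zero => intro p hp; omega
    | succ n ih =>
      intro p hpn
      rcases n with _ | n
      · refine ⟨fun _ => p.coeff 0, ?_⟩
        have h0 : P 0 = 1 := eq_one_of_monic_natDegree_zero (hm 0) (hd 0)
        simpa [h0] using eq_C_of_natDegree_eq_zero (by omega)
      · have hdeg : (p - C (p.coeff (n + 1)) * P (n + 1)).natDegree < n + 1 := by
          have hle : (p - C (p.coeff (n + 1)) * P (n + 1)).natDegree ≤ n + 1 := by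
            refine (natDegree_sub_le _ _).trans (max_le (by omega) ?_)
            exact (natDegree_C_mul_le _ _).trans (hd _).le
          refine lt_of_le_of_ne hle fun heq => ?_
          have hc : (p - C (p.coeff (n + 1)) * P (n + 1)).coeff (n + 1) = 0 := by
            have := (hm (n + 1)).coeff_natDegree
            rw [hd] at this
            simp [this]
          generalize p - C (p.coeff (n + 1)) * P (n + 1) = q at hc heq
          rw [← heq, coeff_natDegree, leadingCoeff_eq_zero] at hc
          rw [hc] at heq
          simp at heq
        obtain ⟨c, hc⟩ := ih _ hdeg
        refine ⟨Function.update c (n + 1) (p.coeff (n + 1)), ?_⟩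
        rw [Finset.sum_range_succ, Function.update_self, ← sub_eq_iff_eq_add]
        refine hc.trans (Finset.sum_congr rfl fun i hi => ?_)
        rw [Function.update_of_ne (Finset.mem_range.1 hi).ne]
  intro p hp0
  obtain ⟨c, hc⟩ := hexp (p.natDegree + 1) p (by omega)
  have hL : L (p * p) = ∑ i ∈ Finset.range (p.natDegree + 1), c i * (c i * L (P i * P i)) := by
    conv_lhs => rw [hc]
    rw [Finset.sum_mul_sum, map_sum]
    refine Finset.sum_congr rfl fun i hi => ?_
    rw [map_sum, Finset.sum_eq_single_of_mem i hi]
    · rw [map_mul_C_mul, mul_assoc, map_C_mul]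
    · intro j _ hj
      rw [map_mul_C_mul, mul_assoc, map_C_mul, ho i j hj.symm]
      simp
  have hnn : ∀ i, 0 ≤ c i * (c i * L (P i * P i)) := fun i => by
    rw [← mul_assoc]
    exact mul_nonneg (mul_self_nonneg _) (hp i).le
  rw [hL]
  refine (Finset.sum_nonneg fun i _ => hnn i).lt_of_ne fun h0 => hp0 ?_
  rw [hc]
  refine Finset.sum_eq_zero fun i hi => ?_
  have := (Finset.sum_eq_zero_iff_of_nonneg fun i _ => hnn i).1 h0.symm i hi
  have hci : c i = 0 := by
    simpa [(hp i).ne'] using this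
  simp [hci]

/-! ### Existence of the orthogonal polynomials -/

/-- The pair `(P_n, P_{n+1})` of consecutive monic orthogonal polynomials of `L`. -/
def opsPair (L : ℝ[X] →ₗ[ℝ] ℝ) : ℕ → ℝ[X] × ℝ[X]
  | 0 => (1, X - C (L X / L 1))
  | n + 1 =>
    let p := opsPair L n
    (p.2, (X - C (L (X * p.2 * p.2) / L (p.2 * p.2))) * p.2
      - C (L (p.2 * p.2) / L (p.1 * p.1)) * p.1)

/-- The Stieltjes procedure: s and t are chosen to make each new polynomial orthogonal to its two
predecessors. Orthogonality to the earlier ones is automatic, because multiplication by x is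
symmetric for L and raises degrees by one only. Positivity on squares keeps the denominators
nonzero. -/
theorem exists_ops {L : ℝ[X] →ₗ[ℝ] ℝ} (hL : IsSqPos L) :
    ∃ (σ τ : ℕ → ℝ) (P : ℕ → ℝ[X]), P 0 = 1 ∧ (∀ k, 0 < τ (k + 1)) ∧
      ThreeTermRecurrence σ τ P ∧ IsMonicOPS L P := by
  let P : ℕ → ℝ[X] := fun n => (opsPair L n).1
  let σ : ℕ → ℝ := fun n => L (X * P n * P n) / L (P n * P n)
  -- At n = 0 the truncated subtraction gives a value that the recurrence never uses.
  let τ : ℕ → ℝ := fun n => L (P n * P n) / L (P (n - 1) * P (n - 1))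
  have h0 : P 0 = 1 := rfl
  have hrec : ThreeTermRecurrence σ τ P :=
    ⟨by simp [P, σ, opsPair], fun k => by simp [P, σ, τ, opsPair]⟩
  have hmd := hrec.monic_natDegree h0
  have hpos : ∀ n, 0 < L (P n * P n) := fun n => hL _ (hmd n).1.ne_zero
  have hortho : ∀ n, ∀ j < n, L (P j * P n) = 0 := by
    intro n
    induction n using Nat.strong_induction_on with
    | _ n ih =>
      intro j hj
      rcases n with _ | _ | n
      · omega
      · obtain rfl : j = 0 := by omega
        have e : P 0 * P 1 = X * P 0 * P 0 - C (σ 0) * (P 0 * P 0) := by rw [hrec.one]; ring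
        rw [e, map_sub, map_C_mul, div_mul_cancel₀ _ (hpos 0).ne', sub_self]
      · have e : P j * P (n + 2) = X * P j * P (n + 1) - C (σ (n + 1)) * (P j * P (n + 1))
            - C (τ (n + 1)) * (P j * P n) := by rw [hrec.add_two]; ring
        rw [e, map_sub, map_sub, map_C_mul, map_C_mul]
        rcases Nat.lt_succ_iff_lt_or_eq.1 hj with hj | rfl
        · have hA : L (P j * P (n + 1)) = 0 := ih (n + 1) (by omega) j hj
          -- Move x onto P_j: in its expansion only P_{j+1} can fail to be orthogonal to P_{n+1}.
          have hB : L (X * P j * P (n + 1)) = L (P (j + 1) * P (n + 1)) := by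
            rcases j with _ | j
            · rw [hrec.X_mul_zero, add_mul, map_add, mul_assoc, map_C_mul, hA]
              simp
            · rw [hrec.X_mul_succ, add_mul, add_mul, map_add, map_add, mul_assoc, mul_assoc,
                map_C_mul, map_C_mul, hA, ih (n + 1) (by omega) j (by omega)]
              simp
          rw [hA, hB]
          -- For j < n all terms vanish; for j = n the definition of `τ` produces the cancellation.
          rcases Nat.lt_succ_iff_lt_or_eq.1 hj with hj | rfl
          · rw [ih (n + 1) (by omega) (j + 1) (by omega), ih n (by omega) j hj]
            simp
          · have : τ (j + 1) * L (P j * P j) = L (P (j + 1) * P (j + 1)) :=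
              div_mul_cancel₀ _ (hpos j).ne'
            rw [this]
            ring
        · have : L (P (n + 1) * P n) = 0 := by rw [mul_comm]; exact ih (n + 1) (by omega) n (by omega)
          rw [this, div_mul_cancel₀ _ (hpos (n + 1)).ne']
          ring
  refine ⟨σ, τ, P, h0, fun k => div_pos (hpos _) (hpos _), hrec, fun n => (hmd n).1,
    fun n => (hmd n).2, fun m n hmn => ?_, fun n => (hpos n).ne'⟩
  rcases lt_or_gt_of_ne hmn with h | h
  · exact hortho n m h
  · rw [mul_comm]; exact hortho m n h

/-- The norms of orthogonal polynomials satisfying a three-term recurrence. -/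
theorem map_sq_succ {L : ℝ[X] →ₗ[ℝ] ℝ} {σ τ : ℕ → ℝ} {P : ℕ → ℝ[X]}
    (h : ThreeTermRecurrence σ τ P) (ho : ∀ m n, m ≠ n → L (P m * P n) = 0) (n : ℕ) :
    L (P (n + 1) * P (n + 1)) = τ (n + 1) * L (P n * P n) := by
  -- L(x P_n P_{n+1}) is computed twice, expanding x P_n here and x P_{n+1} in `h2`.
  have h1 : L (X * P n * P (n + 1)) = L (P (n + 1) * P (n + 1)) := by
    rcases n with _ | n
    · rw [h.X_mul_zero, add_mul, map_add, mul_assoc, map_C_mul, ho 0 1 (by simp)]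
      simp
    · rw [h.X_mul_succ, add_mul, add_mul, map_add, map_add, mul_assoc, mul_assoc,
        map_C_mul, map_C_mul, ho (n + 1) (n + 1 + 1) (by omega), ho n (n + 1 + 1) (by omega)]
      simp
  have h2 : X * P n * P (n + 1) = P n * P (n + 2) + C (σ (n + 1)) * (P n * P (n + 1))
      + C (τ (n + 1)) * (P n * P n) := by
    rw [h.add_two]; ring
  rw [← h1, h2, map_add, map_add, map_C_mul, map_C_mul, ho n (n + 2) (by omega),
    ho n (n + 1) (by omega)]
  simp

/-! ### Recursive matrices -/

section

variable {σ τ : ℕ → ℝ} {P : ℕ → ℝ[X]} {L : ℝ[X] →ₗ[ℝ] ℝ}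

/-- Both sides obey the same recursion in k: the recurrence of P expresses column k + 2 of the left
side by earlier columns, just as (A) determines t_{k+2} r_{n,k+2}. Orthogonality is not assumed; it
is deduced from this identity. -/
theorem IsRecursiveMatrix.map_X_pow_mul {r : ℕ → ℕ → ℝ} (hr : IsRecursiveMatrix σ τ r)
    (h : ThreeTermRecurrence σ τ P) (h0 : P 0 = 1) (hL : ∀ n, L (X ^ n) = r n 0) (k : ℕ) :
    ∀ n, L (X ^ n * P k) = r n k * ∏ i ∈ Finset.range k, τ (i + 1) := by
  induction k using Nat.twoStepInduction with
  | zero => intro n; simp [h0, hL]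
  | one =>
    intro n
    have e : X ^ n * P 1 = X ^ (n + 1) - C (σ 0) * X ^ n := by rw [h.one, h0]; ring
    rw [e, map_sub, map_C_mul, hL, hL, hr.succ_zero]
    simp
    ring
  | more k ih0 ih1 =>
    intro n
    have e : X ^ n * P (k + 2) = X ^ (n + 1) * P (k + 1) - C (σ (k + 1)) * (X ^ n * P (k + 1))
        - C (τ (k + 1)) * (X ^ n * P k) := by rw [h.add_two]; ring
    rw [e, map_sub, map_sub, map_C_mul, map_C_mul, ih0, ih1, ih1, hr.succ_succ]
    simp only [Finset.prod_range_succ]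
    ring

theorem IsRecursiveMatrix.diag {r : ℕ → ℕ → ℝ} (hr : IsRecursiveMatrix σ τ r) (n : ℕ) :
    r n n = 1 := by
  induction n with
  | zero => exact hr.zero_zero
  | succ n ih => rw [hr.succ_succ, ih, hr.eq_zero _ _ (by omega), hr.eq_zero _ _ (by omega)]; simp

/-- The array is lower triangular with unit diagonal, so L(x^i P_n) vanishes for i < n and equals
t_1⋯t_n for i = n. Only the coefficient of x^n in a polynomial of degree at most n survives against
P_n. -/
theorem IsRecursiveMatrix.orthogonal {r : ℕ → ℕ → ℝ} (hr : IsRecursiveMatrix σ τ r)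
    (h : ThreeTermRecurrence σ τ P) (h0 : P 0 = 1) (hL : ∀ n, L (X ^ n) = r n 0) :
    (∀ m n, m ≠ n → L (P m * P n) = 0) ∧
      ∀ n, L (P n * P n) = ∏ i ∈ Finset.range n, τ (i + 1) := by
  have hmd := h.monic_natDegree h0
  have hlow : ∀ (n : ℕ) (p : ℝ[X]), p.natDegree ≤ n →
      L (p * P n) = p.coeff n * ∏ i ∈ Finset.range n, τ (i + 1) := by
    intro n p hp
    conv_lhs => rw [p.as_sum_range_C_mul_X_pow' (Nat.lt_succ_of_le hp)]
    rw [Finset.sum_mul, map_sum, Finset.sum_range_succ, Finset.sum_eq_zero, zero_add, mul_assoc,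
      map_C_mul, hr.map_X_pow_mul h h0 hL, hr.diag, one_mul]
    intro i hi
    rw [mul_assoc, map_C_mul, hr.map_X_pow_mul h h0 hL, hr.eq_zero _ _ (Finset.mem_range.1 hi)]
    simp
  have hlt : ∀ m n, m < n → L (P m * P n) = 0 := by
    intro m n hmn
    rw [hlow n (P m) (by rw [(hmd m).2]; exact hmn.le),
      coeff_eq_zero_of_natDegree_lt (by rw [(hmd m).2]; exact hmn), zero_mul]
  refine ⟨fun m n hmn => ?_, fun n => ?_⟩
  · rcases lt_or_gt_of_ne hmn with h' | h'
    · exact hlt m n h'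
    · rw [mul_comm]; exact hlt n m h'
  · have := (hmd n).1.coeff_natDegree
    rw [(hmd n).2] at this
    rw [hlow n (P n) (hmd n).2.le, this, one_mul]

/-- The converse direction, by induction on rows: x P_k is expanded by the recurrence, and
orthogonality is needed only in row 0, where L(P_k) = 0 for k ≥ 1. Column k = 0 then identifies y
with the first column of the matrix. -/
theorem IsMonicOPS.map_X_pow_mul (hP : IsMonicOPS L P) (h : ThreeTermRecurrence σ τ P)
    (hL : L 1 = 1) (n : ℕ) :
    ∀ k, L (X ^ n * P k) = recursiveMatrix σ τ n k * ∏ i ∈ Finset.range k, τ (i + 1) := by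
  have h0 : P 0 = 1 := eq_one_of_monic_natDegree_zero (hP.monic 0) (hP.natDegree_eq 0)
  have hr := recursiveMatrix_spec σ τ
  induction n with
  | zero =>
    intro k
    rcases k with _ | k
    · simp [h0, hL, hr.zero_zero]
    · have := hP.orthogonal 0 (k + 1) (by omega)
      rw [h0] at this
      rw [pow_zero, this, hr.eq_zero 0 (k + 1) (by omega), zero_mul]
  | succ n ih =>
    intro k
    rw [pow_succ, mul_assoc]
    rcases k with _ | k
    · rw [h.X_mul_zero, mul_add, map_add, map_mul_C_mul, ih, ih, hr.succ_zero]
      simp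
      ring
    · rw [h.X_mul_succ, mul_add, mul_add, map_add, map_add, map_mul_C_mul, map_mul_C_mul,
        ih, ih, ih, hr.succ_succ]
      simp only [Finset.prod_range_succ]
      ring

end

/-! ### Hamburger's theorem -/

open Filter Topology

/-- The functions on `ℝ` whose absolute value is bounded by a polynomial. -/
def polyBounded : Submodule ℝ (ℝ → ℝ) where
  carrier := {f | ∃ p : ℝ[X], ∀ x, |f x| ≤ p.eval x}
  add_mem' := by
    rintro f g ⟨p, hp⟩ ⟨q, hq⟩
    refine ⟨p + q, fun x => ?_⟩
    rw [eval_add]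
    exact (abs_add_le _ _).trans (add_le_add (hp x) (hq x))
  zero_mem' := ⟨0, fun x => by simp⟩
  smul_mem' := by
    rintro c f ⟨p, hp⟩
    refine ⟨C |c| * p, fun x => ?_⟩
    simp only [Pi.smul_apply, smul_eq_mul, eval_mul, eval_C, abs_mul]
    exact mul_le_mul_of_nonneg_left (hp x) (abs_nonneg c)

/-- A polynomial, as a polynomially bounded function. -/
def evalPolyBounded : ℝ[X] →ₗ[ℝ] polyBounded where
  -- The majorant must itself be a polynomial: |p| ≤ 1 + p².
  toFun p := ⟨fun x => p.eval x, 1 + p * p, fun x => by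
    simp only [eval_add, eval_one, eval_mul]
    rw [abs_le]
    constructor <;> nlinarith [sq_nonneg (p.eval x - 1), sq_nonneg (p.eval x + 1)]⟩
  map_add' p q := by ext; simp
  map_smul' c p := by ext; simp

theorem evalPolyBounded_apply (p : ℝ[X]) (x : ℝ) : (evalPolyBounded p).1 x = p.eval x := rfl

theorem evalPolyBounded_injective : Function.Injective evalPolyBounded := fun _ _ h =>
  Polynomial.funext fun x => congrFun (congrArg Subtype.val h) x

/-- The cone of nonnegative polynomially bounded functions. -/
def nonnegCone : PointedCone ℝ polyBounded where
  carrier := {f | ∀ x, 0 ≤ f.1 x}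
  add_mem' := fun hf hg x => add_nonneg (hf x) (hg x)
  zero_mem' := fun _ => le_rfl
  smul_mem' := fun c _ hf x => mul_nonneg c.2 (hf x)

/-- A functional that is nonnegative on nonnegative polynomials extends to a positive functional on
the polynomially bounded functions. -/
theorem exists_positive_extension {L : ℝ[X] →ₗ[ℝ] ℝ}
    (hL : ∀ p : ℝ[X], (∀ x : ℝ, 0 ≤ p.eval x) → 0 ≤ L p) :
    ∃ g : polyBounded →ₗ[ℝ] ℝ, (∀ p, g (evalPolyBounded p) = L p) ∧
      ∀ f : polyBounded, (∀ x, 0 ≤ f.1 x) → 0 ≤ g f := by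
  let e := LinearEquiv.ofInjective evalPolyBounded evalPolyBounded_injective
  have he : ∀ p h, e.symm ⟨evalPolyBounded p, h⟩ = p := fun p h => e.symm_apply_apply p
  let f : polyBounded →ₗ.[ℝ] ℝ :=
    ⟨LinearMap.range evalPolyBounded, L.comp (e.symm : _ →ₗ[ℝ] ℝ[X])⟩
  have hf : ∀ p h, f ⟨evalPolyBounded p, h⟩ = L p := fun p h => congrArg L (he p h)
  -- M. Riesz extension; its cofinality condition holds because every function in the space, added
  -- to a suitable polynomial, becomes nonnegative.
  obtain ⟨g, hg, hg'⟩ := riesz_extension nonnegCone f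
    (by
      rintro ⟨_, p, rfl⟩ hx
      exact (hL p hx).trans_eq (hf p _).symm)
    (by
      rintro ⟨h, p, hp⟩
      refine ⟨⟨evalPolyBounded p, p, rfl⟩, fun x => ?_⟩
      have := (abs_le.1 (hp x)).1
      change 0 ≤ p.eval x + h x
      linarith)
  exact ⟨g, fun p => (hg ⟨evalPolyBounded p, p, rfl⟩).trans (hf p _), hg'⟩

/-- Compactly supported continuous functions are polynomially bounded. -/
def compactPolyBounded : CompactlySupportedContinuousMap ℝ ℝ →ₗ[ℝ] polyBounded where
  toFun f := ⟨f, by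
    obtain ⟨c, hc⟩ := f.hasCompactSupport.exists_bound_of_continuous f.continuous
    exact ⟨C c, fun x => by simpa using hc x⟩⟩
  map_add' f g := by ext; simp
  map_smul' c f := by ext; simp

theorem compactPolyBounded_apply (f : CompactlySupportedContinuousMap ℝ ℝ) (x : ℝ) :
    (compactPolyBounded f).1 x = f x := rfl

/-- A continuous cutoff, supported in `[-(n+1), n+1]` and tending to `1`. -/
def cutoff (n : ℕ) (x : ℝ) : ℝ := max 0 (1 - x ^ 2 / (n + 1 : ℝ) ^ 2)

theorem cutoff_nonneg (n : ℕ) (x : ℝ) : 0 ≤ cutoff n x := le_max_left _ _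

theorem cutoff_le_one (n : ℕ) (x : ℝ) : cutoff n x ≤ 1 := by
  refine max_le zero_le_one ?_
  have : 0 ≤ x ^ 2 / (n + 1 : ℝ) ^ 2 := by positivity
  linarith

theorem one_sub_cutoff_le (n : ℕ) (x : ℝ) : 1 - cutoff n x ≤ x ^ 2 / (n + 1 : ℝ) ^ 2 := by
  have : 1 - x ^ 2 / (n + 1 : ℝ) ^ 2 ≤ cutoff n x := le_max_right _ _
  linarith

theorem continuous_cutoff (n : ℕ) : Continuous (cutoff n) := by
  unfold cutoff
  fun_prop

theorem hasCompactSupport_cutoff (n : ℕ) : HasCompactSupport (cutoff n) := by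
  refine HasCompactSupport.intro (isCompact_Icc (a := -(n + 1 : ℝ)) (b := n + 1)) fun x hx => ?_
  have hn : (0 : ℝ) < n + 1 := by positivity
  have h1 : (n + 1 : ℝ) < |x| := by
    by_contra h
    exact hx (abs_le.1 (not_lt.1 h))
  have h2 : 1 ≤ x ^ 2 / (n + 1 : ℝ) ^ 2 := by
    rw [one_le_div (by positivity), ← sq_abs x]
    exact pow_le_pow_left₀ hn.le h1.le 2
  exact max_eq_left (by linarith)

theorem tendsto_const_div_succ_sq (c : ℝ) :
    Tendsto (fun n : ℕ => c / (n + 1 : ℝ) ^ 2) atTop (𝓝 0) := by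
  have h : Tendsto (fun n : ℕ => 1 / ((n : ℝ) + 1)) atTop (𝓝 0) :=
    tendsto_one_div_add_atTop_nhds_zero_nat
  have := (h.pow 2).const_mul c
  simpa [div_eq_mul_inv] using this

theorem tendsto_cutoff (x : ℝ) : Tendsto (fun n => cutoff n x) atTop (𝓝 1) := by
  have h := (tendsto_const_div_succ_sq (x ^ 2)).const_sub 1
  rw [sub_zero] at h
  exact tendsto_of_tendsto_of_tendsto_of_le_of_le h tendsto_const_nhds
    (fun n => le_max_right _ _) fun n => cutoff_le_one n x

/-- The product of a polynomial and a cutoff. -/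
def cutoffMul (n : ℕ) (p : ℝ[X]) : CompactlySupportedContinuousMap ℝ ℝ where
  toFun x := p.eval x * cutoff n x
  continuous_toFun := p.continuous.mul (continuous_cutoff n)
  hasCompactSupport' := (hasCompactSupport_cutoff n).mul_left

theorem cutoffMul_apply (n : ℕ) (p : ℝ[X]) (x : ℝ) :
    cutoffMul n p x = p.eval x * cutoff n x := rfl

/-- Hamburger's theorem: a functional that is nonnegative on nonnegative polynomials is given by
integration. -/
theorem exists_measure_of_nonneg {L : ℝ[X] →ₗ[ℝ] ℝ}
    (hL : ∀ p : ℝ[X], (∀ x : ℝ, 0 ≤ p.eval x) → 0 ≤ L p) :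
    ∃ μ : Measure ℝ, ∀ p : ℝ[X], Integrable (fun x => p.eval x) μ ∧ ∫ x, p.eval x ∂μ = L p := by
  obtain ⟨g, hgL, hg⟩ := exists_positive_extension hL
  have hmono : ∀ f h : polyBounded, (∀ x, f.1 x ≤ h.1 x) → g f ≤ g h := fun f h hfh => by
    have := hg (h - f) fun x => sub_nonneg.2 (hfh x)
    rw [map_sub] at this
    linarith
  let Λ : CompactlySupportedContinuousMap ℝ ℝ →ₚ[ℝ] ℝ :=
    PositiveLinearMap.mk₀ (g.comp compactPolyBounded) fun f hf => hg _ fun x => hf x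
  have hΛ : ∀ f, ∫ x, f x ∂(RealRMK.rieszMeasure Λ) = g (compactPolyBounded f) := fun f =>
    RealRMK.integral_rieszMeasure Λ f
  have hlim : ∀ p : ℝ[X], Tendsto (fun n => g (compactPolyBounded (cutoffMul n p))) atTop
      (𝓝 (L p)) := by
    intro p
    -- Pointwise, |p|(1 - cutoff) ≤ (1 + p²)x²/(n+1)². The right side is a polynomial, where `g`
    -- agrees with `L`, so the error is O(1/n²).
    have hb : ∀ n, |g (compactPolyBounded (cutoffMul n p)) - L p| ≤
        L ((1 + p * p) * X ^ 2) / (n + 1 : ℝ) ^ 2 := by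
      intro n
      have hpt : ∀ x : ℝ, |p.eval x * cutoff n x - p.eval x| ≤
          ((n + 1 : ℝ) ^ 2)⁻¹ * ((1 + p.eval x * p.eval x) * x ^ 2) := by
        intro x
        rw [show p.eval x * cutoff n x - p.eval x = -(p.eval x * (1 - cutoff n x)) by ring,
          abs_neg, abs_mul, abs_of_nonneg (sub_nonneg.2 (cutoff_le_one n x))]
        have h1 : |p.eval x| ≤ 1 + p.eval x * p.eval x := by
          rw [abs_le]
          constructor <;> nlinarith [sq_nonneg (p.eval x - 1), sq_nonneg (p.eval x + 1)]
        calc |p.eval x| * (1 - cutoff n x)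
            ≤ (1 + p.eval x * p.eval x) * (x ^ 2 / (n + 1 : ℝ) ^ 2) :=
              mul_le_mul h1 (one_sub_cutoff_le n x) (sub_nonneg.2 (cutoff_le_one n x))
                ((abs_nonneg _).trans h1)
          _ = _ := by ring
      have he : L ((1 + p * p) * X ^ 2) / (n + 1 : ℝ) ^ 2 =
          g (evalPolyBounded (((n + 1 : ℝ) ^ 2)⁻¹ • ((1 + p * p) * X ^ 2))) := by
        rw [hgL, map_smul, smul_eq_mul, div_eq_inv_mul]
      rw [he, ← hgL p, ← map_sub, abs_le, ← map_neg]
      constructor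
      · refine hmono _ _ fun x => ?_
        have := (abs_le.1 (hpt x)).1
        simpa [evalPolyBounded_apply, compactPolyBounded_apply, cutoffMul_apply] using this
      · refine hmono _ _ fun x => ?_
        have := (abs_le.1 (hpt x)).2
        simpa [evalPolyBounded_apply, compactPolyBounded_apply, cutoffMul_apply] using this
    rw [tendsto_iff_norm_sub_tendsto_zero]
    exact squeeze_zero (fun _ => norm_nonneg _) hb (tendsto_const_div_succ_sq _)
  have hptlim : ∀ (p : ℝ[X]) (x : ℝ), Tendsto (fun n => cutoffMul n p x) atTop (𝓝 (p.eval x)) := by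
    intro p x
    simpa [cutoffMul_apply] using (tendsto_cutoff x).const_mul (p.eval x)
  have hmeas : ∀ (p : ℝ[X]) n, AEStronglyMeasurable (fun x => cutoffMul n p x)
      (RealRMK.rieszMeasure Λ) := fun p n => (cutoffMul n p).continuous.aestronglyMeasurable
  have hint_nonneg : ∀ p : ℝ[X], (∀ x : ℝ, 0 ≤ p.eval x) →
      Integrable (fun x => p.eval x) (RealRMK.rieszMeasure Λ) := by
    intro p hp
    -- Fatou: the truncated integrals stay below L(p), since the cutoff is at most 1.
    refine integrable_of_tendsto (Eventually.of_forall (hptlim p)) (hmeas p) ?_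
    have hle : ∀ n, ∫⁻ x, ‖cutoffMul n p x‖ₑ ∂(RealRMK.rieszMeasure Λ) ≤ ENNReal.ofReal (L p) := by
      intro n
      have hnn : ∀ x, 0 ≤ cutoffMul n p x := fun x => mul_nonneg (hp x) (cutoff_nonneg n x)
      have hi : Integrable (fun x => cutoffMul n p x) (RealRMK.rieszMeasure Λ) :=
        (cutoffMul n p).continuous.integrable_of_hasCompactSupport (cutoffMul n p).hasCompactSupport
      rw [← ofReal_integral_norm_eq_lintegral_enorm hi]
      refine ENNReal.ofReal_le_ofReal ?_
      simp_rw [Real.norm_of_nonneg (hnn _)]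
      rw [hΛ, ← hgL]
      exact hmono _ _ fun x => mul_le_of_le_one_right (hp x) (cutoff_le_one n x)
    have hlim_le : liminf (fun n => ∫⁻ x, ‖cutoffMul n p x‖ₑ ∂(RealRMK.rieszMeasure Λ)) atTop ≤
        ENNReal.ofReal (L p) :=
      liminf_le_of_frequently_le' (Frequently.of_forall hle)
    exact (hlim_le.trans_lt ENNReal.ofReal_lt_top).ne
  have hint : ∀ p : ℝ[X], Integrable (fun x => p.eval x) (RealRMK.rieszMeasure Λ) := by
    intro p
    refine (hint_nonneg (1 + p * p) fun x => ?_).mono' p.continuous.aestronglyMeasurable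
      (Eventually.of_forall fun x => ?_)
    · have := mul_self_nonneg (p.eval x)
      simp only [eval_add, eval_one, eval_mul]
      linarith
    · rw [Real.norm_eq_abs, abs_le]
      simp only [eval_add, eval_one, eval_mul]
      constructor <;> nlinarith [sq_nonneg (p.eval x - 1), sq_nonneg (p.eval x + 1)]
  refine ⟨RealRMK.rieszMeasure Λ, fun p => ⟨hint p, ?_⟩⟩
  have hdom := tendsto_integral_of_dominated_convergence (μ := RealRMK.rieszMeasure Λ)
    (fun x => ‖p.eval x‖) (hmeas p) (hint p).norm
    (fun n => Eventually.of_forall fun x => by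
      rw [cutoffMul_apply, norm_mul, Real.norm_of_nonneg (cutoff_nonneg n x)]
      exact mul_le_of_le_one_right (norm_nonneg _) (cutoff_le_one n x))
    (Eventually.of_forall (hptlim p))
  refine tendsto_nhds_unique hdom ?_
  simp_rw [hΛ]
  exact hlim p

/-! ### Strict positivity and infinite support -/

theorem admitsInfiniteMeasure_of_isPosDefFunctional {y : ℕ → ℝ}
    (h : IsPosDefFunctional (riesz y)) : AdmitsInfiniteMeasure y := by
  obtain ⟨μ, hμ⟩ := exists_measure_of_nonneg (L := riesz y) fun p hp => by
    by_cases h0 : p = 0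
    · simp [h0]
    · exact (h p h0 hp).le
  refine ⟨Set.univ, μ, ⟨isClosed_univ, Set.subset_univ _, fun n => ?_, fun n => ?_⟩, fun hfin => ?_⟩
  · simpa using (hμ (X ^ n)).1
  · have := (hμ (X ^ n)).2
    rw [riesz_X_pow] at this
    simpa using this.symm
  -- If the support were finite, this nonnegative polynomial would vanish on it and have integral
  -- zero.
  · let p : ℝ[X] := ∏ a ∈ hfin.toFinset, (X - C a) ^ 2
    have hp0 : p ≠ 0 := Finset.prod_ne_zero_iff.2 fun a _ => pow_ne_zero 2 (X_sub_C_ne_zero a)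
    have hpnn : ∀ x, 0 ≤ p.eval x := fun x => by
      rw [eval_prod]
      exact Finset.prod_nonneg fun a _ => by simpa using sq_nonneg (x - a)
    have hpos := h p hp0 hpnn
    rw [← (hμ p).2, integral_eq_zero_of_ae] at hpos
    · exact lt_irrefl _ hpos
    · filter_upwards [Measure.support_mem_ae (μ := μ)] with x hx
      rw [eval_prod]
      exact Finset.prod_eq_zero (hfin.mem_toFinset.2 hx) (by simp)

/-- If a nonnegative p has integral zero, its zero set is closed of full measure and so contains the
support; an infinite support then forces p = 0. -/
theorem isPosDefFunctional_of_admitsInfiniteMeasure {y : ℕ → ℝ} (h : AdmitsInfiniteMeasure y) :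
    IsPosDefFunctional (riesz y) := by
  obtain ⟨K, μ, hμ, hinf⟩ := h
  -- The support carries all the mass, so integrating over K is integrating over ℝ.
  have hrestr : μ.restrict K = μ :=
    Measure.restrict_eq_self_of_ae_mem
      (Filter.mem_of_superset Measure.support_mem_ae hμ.support_subset)
  have hint : ∀ n : ℕ, Integrable (fun x : ℝ => x ^ n) μ := fun n => by
    have := hμ.integrable n
    rwa [IntegrableOn, hrestr] at this
  have hmom : ∀ n : ℕ, y n = ∫ x, x ^ n ∂μ := fun n => by
    have := hμ.moment n
    rwa [hrestr] at this
  have hp : ∀ p : ℝ[X], Integrable (fun x => p.eval x) μ ∧ ∫ x, p.eval x ∂μ = riesz y p := by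
    intro p
    have he : (fun x : ℝ => p.eval x) =
        fun x => ∑ i ∈ Finset.range (p.natDegree + 1), p.coeff i * x ^ i :=
      _root_.funext fun x => eval_eq_sum_range x
    constructor
    · rw [he]
      exact integrable_finsetSum _ fun i _ => (hint i).const_mul _
    · rw [he, integral_finsetSum _ fun i _ => (hint i).const_mul _]
      conv_rhs => rw [p.as_sum_range_C_mul_X_pow, map_sum]
      refine Finset.sum_congr rfl fun i _ => ?_
      rw [integral_const_mul, map_C_mul, riesz_X_pow, hmom]
  intro p hp0 hpnn
  rw [← (hp p).2]
  refine (integral_nonneg hpnn).lt_of_ne fun h0 => hinf ?_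
  have hae := (integral_eq_zero_iff_of_nonneg hpnn (hp p).1).1 h0.symm
  have hroots : {x : ℝ | p.IsRoot x}.Finite := by
    simpa [Set.ext_iff] using finite_setOfPred_isRoot hp0
  refine hroots.subset (Measure.support_subset_of_isClosed ?_ hae)
  exact isClosed_singleton.preimage p.continuous

/-! ### Each condition against positivity on squares -/

/-- The norms are L(P_n²) = y_0 t_1⋯t_n. The sign of y_0 has to be given: y and -y have the same
orthogonal polynomials and the same recurrence. -/
theorem isSqPos_of_recurrence {y : ℕ → ℝ} (h0 : 0 < y 0) (h : HasPosOPSRecurrence y) :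
    IsSqPos (riesz y) := by
  obtain ⟨σ, τ, hτ, P, hP, hrec⟩ := h
  refine isSqPos_of_orthogonal hP.monic hP.natDegree_eq hP.orthogonal fun n => ?_
  induction n with
  | zero =>
    rw [eq_one_of_monic_natDegree_zero (hP.monic 0) (hP.natDegree_eq 0), mul_one, riesz_one]
    exact h0
  | succ n ih =>
    rw [map_sq_succ hrec hP.orthogonal]
    exact mul_pos (hτ n) ih

theorem hasPosOPSRecurrence_of_isSqPos {y : ℕ → ℝ} (h : IsSqPos (riesz y)) :
    HasPosOPSRecurrence y := by
  obtain ⟨σ, τ, P, -, hτ, hrec, hP⟩ := exists_ops h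
  exact ⟨σ, τ, hτ, P, hP, hrec⟩

theorem hasPosDefFavard_of_isSqPos {y : ℕ → ℝ} (h : IsSqPos (riesz y)) : HasPosDefFavard y := by
  obtain ⟨σ, τ, P, h0, -, hrec, hP⟩ := exists_ops h
  -- The recurrence involves only t_k with k ≥ 1, so t_0 is free to be set to y_0.
  refine ⟨isPosDefFunctional_iff_isSqPos.2 h, σ, Function.update τ 0 (y 0), P, h0,
    ⟨hrec.one, fun k => ?_⟩, by simp [riesz_one], hP.orthogonal⟩
  rw [Function.update_of_ne (Nat.succ_ne_zero k), hrec.add_two]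

theorem hasPosRecursiveMatrix_of_isSqPos {y : ℕ → ℝ} (h : IsSqPos (riesz y)) (hy : y 0 = 1) :
    HasPosRecursiveMatrix y := by
  obtain ⟨σ, τ, P, h0, hτ, hrec, hP⟩ := exists_ops h
  refine ⟨σ, τ, hτ, fun n => ?_⟩
  have := hP.map_X_pow_mul hrec (by rw [riesz_one, hy]) n 0
  rw [h0, mul_one, riesz_X_pow] at this
  simpa using this.symm

/-- The positivity of the norms is left as a hypothesis because it has two sources: t_k > 0
directly, or t_k ≠ 0 together with L ≥ 0 on squares. -/
theorem isSqPos_of_isRecursiveMatrix {y : ℕ → ℝ} {σ τ : ℕ → ℝ} {r : ℕ → ℕ → ℝ}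
    (hr : IsRecursiveMatrix σ τ r) (hy : ∀ n, r n 0 = y n)
    (hpos : ∀ n, riesz y (recPoly σ τ n * recPoly σ τ n) = ∏ i ∈ Finset.range n, τ (i + 1) →
      0 < riesz y (recPoly σ τ n * recPoly σ τ n)) : IsSqPos (riesz y) := by
  have hrec := recPoly_spec σ τ
  have hmd := hrec.monic_natDegree (by rw [recPoly])
  obtain ⟨ho, hn⟩ := hr.orthogonal hrec (by rw [recPoly]) fun n => by rw [riesz_X_pow, hy]
  exact isSqPos_of_orthogonal (fun n => (hmd n).1) (fun n => (hmd n).2) ho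
    fun n => hpos n (hn n)

theorem isSqPos_of_hasPosMatrixRecurrence {y : ℕ → ℝ} (h : HasPosMatrixRecurrence y) :
    IsSqPos (riesz y) := by
  obtain ⟨σ, τ, hτ, r, hr, hy⟩ := h
  refine isSqPos_of_isRecursiveMatrix hr hy fun n hn => ?_
  rw [hn]
  exact Finset.prod_pos fun i _ => hτ i

theorem isSqPos_of_isCatalanLike {y : ℕ → ℝ} (hp : IsPositiveSeq y) (h : IsCatalanLike y) :
    IsSqPos (riesz y) := by
  obtain ⟨σ, τ, hτ, hy⟩ := h
  refine isSqPos_of_isRecursiveMatrix (recursiveMatrix_spec σ τ) hy fun n hn => ?_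
  refine (hp _ fun x => by simpa using mul_self_nonneg _).lt_of_ne' ?_
  rw [hn]
  exact Finset.prod_ne_zero_iff.2 fun i _ => hτ i

end CatalanLike
end

theorem mainTheorem8 (y : ℕ → ℝ) :
    (y 0 = 1 →
      [CatalanLike.IsPositiveSeq y ∧ CatalanLike.IsCatalanLike y,
        CatalanLike.IsPosDefSeq y,
        ∀ m, 0 < CatalanLike.hankelDet y m,
        CatalanLike.AdmitsInfiniteMeasure y,
        CatalanLike.HasPosRecursiveMatrix y,
        CatalanLike.HasPosDefMonicOPS y,
        CatalanLike.HasPosOPSRecurrence y,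
        CatalanLike.HasPosMatrixRecurrence y,
        CatalanLike.HasPosDefFavard y].TFAE) ∧
    [CatalanLike.IsPosDefSeq y,
      ∀ m, 0 < CatalanLike.hankelDet y m,
      CatalanLike.AdmitsInfiniteMeasure y,
      CatalanLike.HasPosDefMonicOPS y,
      0 < y 0 ∧ CatalanLike.HasPosOPSRecurrence y,
      CatalanLike.HasPosDefFavard y].TFAE := by
  open CatalanLike in
  have general : [IsPosDefSeq y, ∀ m, 0 < hankelDet y m, AdmitsInfiniteMeasure y,
      HasPosDefMonicOPS y, 0 < y 0 ∧ HasPosOPSRecurrence y, HasPosDefFavard y].TFAE := by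
    tfae_have 1 ↔ 2 := isPosDefSeq_iff_hankelDet_pos
    tfae_have 1 → 3 := fun h => admitsInfiniteMeasure_of_isPosDefFunctional
      (isPosDefFunctional_iff_isSqPos.2 (isPosDefSeq_iff_isSqPos.1 h))
    tfae_have 3 → 1 := fun h => isPosDefSeq_iff_isSqPos.2
      (isPosDefFunctional_iff_isSqPos.1 (isPosDefFunctional_of_admitsInfiniteMeasure h))
    tfae_have 1 → 5 := fun h => by
      have hs := isPosDefSeq_iff_isSqPos.1 h
      exact ⟨by simpa [riesz_one] using hs 1 one_ne_zero, hasPosOPSRecurrence_of_isSqPos hs⟩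
    tfae_have 5 → 1 := fun h => isPosDefSeq_iff_isSqPos.2 (isSqPos_of_recurrence h.1 h.2)
    tfae_have 1 → 4 := fun h => by
      have hs := isPosDefSeq_iff_isSqPos.1 h
      obtain ⟨_, _, P, _, _, _, hP⟩ := exists_ops hs
      exact ⟨isPosDefFunctional_iff_isSqPos.2 hs, P, hP⟩
    tfae_have 4 → 1 := fun h => isPosDefSeq_iff_isSqPos.2 (isPosDefFunctional_iff_isSqPos.1 h.1)
    tfae_have 1 → 6 := fun h => hasPosDefFavard_of_isSqPos (isPosDefSeq_iff_isSqPos.1 h)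
    tfae_have 6 → 1 := fun h => isPosDefSeq_iff_isSqPos.2 (isPosDefFunctional_iff_isSqPos.1 h.1)
    tfae_finish
  refine ⟨fun hy => ?_, general⟩
  open CatalanLike in
  have hrec : IsPosDefSeq y ↔ 0 < y 0 ∧ HasPosOPSRecurrence y := general.out 0 4
  tfae_have 2 ↔ 3 := general.out 0 1
  tfae_have 2 ↔ 4 := general.out 0 2
  tfae_have 2 ↔ 6 := general.out 0 3
  tfae_have 2 ↔ 9 := general.out 0 5
  tfae_have 2 ↔ 7 := by simpa [hy] using hrec
  tfae_have 2 → 5 := fun h => hasPosRecursiveMatrix_of_isSqPos (isPosDefSeq_iff_isSqPos.1 h) hy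
  tfae_have 5 → 8 := fun ⟨σ, τ, hτ, h⟩ => ⟨σ, τ, hτ, _, recursiveMatrix_spec σ τ, h⟩
  tfae_have 8 → 2 := fun h => isPosDefSeq_iff_isSqPos.2 (isSqPos_of_hasPosMatrixRecurrence h)
  tfae_have 1 → 2 := fun h => isPosDefSeq_iff_isSqPos.2 (isSqPos_of_isCatalanLike h.1 h.2)
  tfae_have 2 → 1 := fun h => by
    have hs := isPosDefSeq_iff_isSqPos.1 h
    have hpd := isPosDefFunctional_iff_isSqPos.2 hs
    obtain ⟨σ, τ, hτ, hr⟩ := hasPosRecursiveMatrix_of_isSqPos hs hy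
    refine ⟨fun p hp => ?_, σ, τ, fun k => (hτ k).ne', hr⟩
    by_cases h0 : p = 0
    · simp [h0]
    · exact (hpd p h0 hp).le
  tfae_finish
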